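/- Let $K$ be a solenoid, that is, a compact (Hausdorff) connected abelian topological group of finite topological dimension, with normalized Haar measure $m$. Let $\Gamma$ be a group, with the discrete topology, acting on $K$ by continuous automorphisms (for instance, any group of automorphisms of $K$). Let $\pi_0$ be the unitary representation of $\Gamma$ on $L^2_0(K)=\{f\in L^2(K,m) : \int_K f\,dm=0\}$ given by $\pi_0(\alpha)f(x)=f(\alpha^{-1}(x))$ for $\alpha\in\Gamma$, $x\in K$. Suppose that $(\Gamma,K)$ has strong relative property $(T)$: for every strongly continuous unitary representation $\pi$ of the semidirect product $\Gamma\ltimes K$ (with the product topology) on a Hilbert space, if $\pi|_\Gamma$ weakly contains the trivial representation (that is, for every compact $Q\subset\Gamma$ and every $\varepsilon>0$ there is a vector $v$ with $\sup_{g\in Q}\|\pi(g)v-v\|<\varepsilon\|v\|$), then there is a nonzero $\pi(K)$-invariant vector. Let $\mu$ be a regular Borel probability measure on $\Gamma$ that is adapted, that is, whose support is not contained in any proper closed subgroup of $\Gamma$. Then the spectral radius of the operator $\pi_0(\mu)$ on $L^2_0(K)$, defined by $\pi_0(\mu)f=\int_\Gamma \pi_0(\alpha)f\,d\mu(\alpha)$,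 satisfies $$\mathrm{Spr}(\pi_0(\mu))<1 .$$ -/

import Mathlib

open MeasureTheory TopologicalSpace
open scoped ENNReal

universe u v w

noncomputable section

/-! ### Unitary representations -/

/-- A strongly continuous unitary representation of a topological group `G` on `E`. -/
structure UnitaryRep (G : Type u) [Group G] [TopologicalSpace G]
    (E : Type v) [NormedAddCommGroup E] [InnerProductSpace ℂ E] where
  /-- the homomorphism to the unitary group of `E` -/
  toHom : G →* (E ≃ₗᵢ[ℂ] E)
  /-- strong continuity -/
  continuous_apply : ∀ v : E, Continuous fun g => toHom g v

namespace UnitaryRep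

variable {G : Type u} [Group G] [TopologicalSpace G]
  {E : Type v} [NormedAddCommGroup E] [InnerProductSpace ℂ E]

/-- Restriction of a unitary representation to a subgroup (with the subspace topology). -/
def restrict (π : UnitaryRep G E) (H : Subgroup G) : UnitaryRep H E where
  toHom := π.toHom.comp H.subtype
  continuous_apply v := (π.continuous_apply v).comp continuous_subtype_val

/-- `I ≺ π`: for every compact set `Q` and every `ε > 0` there is a (necessarily nonzero)
vector `v` with `sup_{g ∈ Q} ‖π(g) v - v‖ < ε ‖v‖`.  (The supremum of a continuous function
over a compact set is attained, so the strict bound may be written pointwise.) -/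
def WeaklyContainsTrivial (π : UnitaryRep G E) : Prop :=
  ∀ Q : Set G, IsCompact Q → ∀ ε : ℝ, 0 < ε →
    ∃ v : E, v ≠ 0 ∧ ∀ g ∈ Q, ‖π.toHom g v - v‖ < ε * ‖v‖

/-- `π(N)` has nontrivial invariant vectors. -/
def HasInvariantVectors (π : UnitaryRep G E) (N : Subgroup G) : Prop :=
  ∃ v : E, v ≠ 0 ∧ ∀ g ∈ N, π.toHom g v = v

end UnitaryRep

/-! ### Relative property (T) -/

/-- The triple `(G, H, N)` has relative property (T): every unitary representation `π` of `G`
on a Hilbert space with `I ≺ π|_H` has a nonzero `N`-invariant vector. -/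
def RelativePropertyT (G : Type u) [Group G] [TopologicalSpace G] (H N : Subgroup G) : Prop :=
  ∀ (E : Type u) [NormedAddCommGroup E] [InnerProductSpace ℂ E] [CompleteSpace E]
    (π : UnitaryRep G E), (π.restrict H).WeaklyContainsTrivial → π.HasInvariantVectors N

/-- The semidirect product carries the product topology. -/
instance SemidirectProduct.instTopologicalSpaceProd {N : Type u} {H : Type v} [Group N] [Group H]
    [TopologicalSpace N] [TopologicalSpace H] (φ : H →* MulAut N) :
    TopologicalSpace (N ⋊[φ] H) :=
  TopologicalSpace.induced (fun a => (a.left, a.right)) inferInstance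

/-- For a topological group `H` acting by automorphisms on a topological group `N`, the pair
`(H, N)` has strong relative property (T) if `(H ⋉ N, H, N)` has relative property (T). -/
def StrongRelativePropertyT (H : Type u) (N : Type v) [Group H] [TopologicalSpace H]
    [Group N] [TopologicalSpace N] [MulDistribMulAction H N] : Prop :=
  RelativePropertyT (N ⋊[MulDistribMulAction.toMulAut H N] H)
    (SemidirectProduct.inr : H →* N ⋊[MulDistribMulAction.toMulAut H N] H).range
    (SemidirectProduct.inl : N →* N ⋊[MulDistribMulAction.toMulAut H N] H).range

/-! ### Averages of representations, adapted measures -/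

section Average

/-- A continuous map into a metric space is a.e. strongly measurable for a finite regular
measure. -/
theorem aestronglyMeasurable_of_continuous_of_regular {X : Type u} {E : Type v}
    [TopologicalSpace X] [R1Space X] [MeasurableSpace X] [BorelSpace X] (μ : Measure X)
    [IsFiniteMeasure μ] [μ.Regular] [NormedAddCommGroup E] {f : X → E} (hf : Continuous f) :
    AEStronglyMeasurable f μ := by
  have h : ∀ n : ℕ, ∃ Q : Set X, Q ⊆ Set.univ ∧ IsCompact Q ∧ IsClosed Q ∧
      μ (Set.univ \ Q) < ((n : ℝ≥0∞) + 1)⁻¹ := fun n =>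
    MeasurableSet.univ.exists_isCompact_isClosed_sdiff_lt (measure_ne_top μ _)
      (ENNReal.inv_ne_zero.2 (by finiteness))
  choose Q _ hQc hQcl hQ using h
  have h0 : μ (⋃ n, Q n)ᶜ = 0 := by
    refine le_antisymm (ENNReal.le_of_forall_pos_le_add fun ε hε _ => ?_) bot_le
    obtain ⟨n, hn⟩ := ENNReal.exists_inv_nat_lt (a := (ε : ℝ≥0∞)) (by exact_mod_cast hε.ne')
    calc μ (⋃ n, Q n)ᶜ ≤ μ (Set.univ \ Q n) := by
          refine measure_mono fun x hx => ⟨trivial, fun hxn => hx (Set.mem_iUnion.2 ⟨n, hxn⟩)⟩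
      _ ≤ ((n : ℝ≥0∞) + 1)⁻¹ := (hQ n).le
      _ ≤ (n : ℝ≥0∞)⁻¹ := ENNReal.inv_le_inv.2 le_self_add
      _ ≤ 0 + ε := by simpa using hn.le
  have h1 : AEStronglyMeasurable f (μ.restrict (⋃ n, Q n)) :=
    aestronglyMeasurable_iUnion_iff.2 fun n =>
      hf.continuousOn.aestronglyMeasurable_of_isCompact (hQc n) (hQcl n).measurableSet
  rwa [Measure.restrict_eq_self_of_ae_mem] at h1
  exact h0

variable {G : Type u} [Group G] [TopologicalSpace G] [IsTopologicalGroup G] [MeasurableSpace G]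
  [BorelSpace G] {E : Type v} [NormedAddCommGroup E] [InnerProductSpace ℂ E]

theorem UnitaryRep.integrable_apply (π : UnitaryRep G E) (μ : Measure G)
    [IsProbabilityMeasure μ] [μ.Regular] (v : E) : Integrable (fun g => π.toHom g v) μ :=
  Integrable.of_bound (aestronglyMeasurable_of_continuous_of_regular μ (π.continuous_apply v))
    ‖v‖ (.of_forall fun g => ((π.toHom g).norm_map v).le)

/-- The `μ`-average `π(μ)`, i.e. the bounded operator `v ↦ ∫ π(g) v dμ(g)`. -/
def UnitaryRep.average [CompleteSpace E] (π : UnitaryRep G E) (μ : Measure G) [IsProbabilityMeasure μ]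
    [μ.Regular] : E →L[ℂ] E :=
  LinearMap.mkContinuous
    { toFun := fun v => ∫ g, π.toHom g v ∂μ
      map_add' := fun v w => by
        simp only [map_add]
        exact integral_add (π.integrable_apply μ v) (π.integrable_apply μ w)
      map_smul' := fun c v => by
        simp only [map_smul, RingHom.id_apply]
        exact integral_smul c _ }
    1 (fun v => by
      have h := norm_integral_le_of_norm_le_const (μ := μ) (f := fun g => π.toHom g v)
        (C := ‖v‖) (.of_forall fun g => ((π.toHom g).norm_map v).le)
      simpa using h)

/-- `μ` is adapted: no proper closed subgroup contains the support of `μ`. -/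
def IsAdapted (μ : Measure G) : Prop :=
  ∀ L : Subgroup G, IsClosed (L : Set G) → μ.support ⊆ L → L = ⊤

end Average

/-! ### The Koopman representation on mean-zero functions -/

section Koopman

variable {X : Type v} [MeasurableSpace X]

/-- `L²₀(X, m) = {f ∈ L²(X, m) | ∫ f dm = 0}`. -/
def L2Zero (m : Measure X) [IsProbabilityMeasure m] : Submodule ℂ (Lp ℂ 2 m) where
  carrier := {f | ∫ x, f x ∂m = 0}
  add_mem' {f g} hf hg := by
    have hf' : ∫ x, f x ∂m = 0 := hf
    have hg' : ∫ x, g x ∂m = 0 := hg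
    have e : ∫ x, (f + g) x ∂m = ∫ x, (f x + g x) ∂m := integral_congr_ae (Lp.coeFn_add f g)
    change ∫ x, (f + g) x ∂m = 0
    rw [e, integral_add ((Lp.memLp f).integrable (by norm_num))
      ((Lp.memLp g).integrable (by norm_num)), hf', hg', add_zero]
  zero_mem' := by
    change ∫ x, (0 : Lp ℂ 2 m) x ∂m = 0
    rw [integral_congr_ae (Lp.coeFn_zero ℂ 2 m)]
    simp
  smul_mem' c f hf := by
    have hf' : ∫ x, f x ∂m = 0 := hf
    have e : ∫ x, (c • f) x ∂m = ∫ x, c • f x ∂m := integral_congr_ae (Lp.coeFn_smul c f)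
    change ∫ x, (c • f) x ∂m = 0
    rw [e, integral_smul, hf', smul_zero]

theorem mem_L2Zero {m : Measure X} [IsProbabilityMeasure m] {f : Lp ℂ 2 m} :
    f ∈ L2Zero m ↔ ∫ x, f x ∂m = 0 := Iff.rfl

instance L2Zero.instCompleteSpace (m : Measure X) [IsProbabilityMeasure m] :
    CompleteSpace (L2Zero m) := by
  have h : IsClosed ((L2Zero m : Submodule ℂ (Lp ℂ 2 m)) : Set (Lp ℂ 2 m)) := by
    have e : ((L2Zero m : Submodule ℂ (Lp ℂ 2 m)) : Set (Lp ℂ 2 m)) =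
        {f | inner ℂ (indicatorConstLp 2 MeasurableSet.univ (measure_ne_top m _) (1 : ℂ)) f
          = 0} := by
      ext f
      rw [Set.mem_ofPred_eq, L2.inner_indicatorConstLp_one, setIntegral_univ]
      rfl
    rw [e]
    exact isClosed_eq (continuous_const.inner continuous_id) continuous_const
  exact h.completeSpace_coe

variable (Γ : Type u) [Group Γ] [MulAction Γ X] [MeasurableConstSMul Γ X]

/-- The isometry `f ↦ f ∘ γ⁻¹` of `L²₀(X, m)`. -/
def koopmanIsometry (m : Measure X) [IsProbabilityMeasure m] [SMulInvariantMeasure Γ X m]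
    (γ : Γ) : L2Zero m →ₗᵢ[ℂ] L2Zero m where
  toFun f := ⟨Lp.compMeasurePreserving (γ⁻¹ • ·) (measurePreserving_smul γ⁻¹ m) f.1, by
    rw [mem_L2Zero, integral_congr_ae (Lp.coeFn_compMeasurePreserving f.1
      (measurePreserving_smul γ⁻¹ m))]
    exact ((measurePreserving_smul γ⁻¹ m).integral_comp
      (measurableEmbedding_const_smul γ⁻¹) _).trans f.2⟩
  map_add' f g := Subtype.ext (map_add _ _ _)
  map_smul' c f := Subtype.ext
    ((Lp.compMeasurePreservingₗ ℂ (γ⁻¹ • ·) (measurePreserving_smul γ⁻¹ m)).map_smul c f.1)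
  norm_map' f := Lp.norm_compMeasurePreserving f.1 (measurePreserving_smul γ⁻¹ m)

theorem koopmanIsometry_coeFn (m : Measure X) [IsProbabilityMeasure m]
    [SMulInvariantMeasure Γ X m] (γ : Γ) (f : L2Zero m) :
    ((koopmanIsometry Γ m γ f : Lp ℂ 2 m) : X → ℂ) =ᵐ[m]
      fun x => (f : Lp ℂ 2 m) (γ⁻¹ • x) :=
  Lp.coeFn_compMeasurePreserving f.1 (measurePreserving_smul γ⁻¹ m)

theorem koopmanIsometry_one (m : Measure X) [IsProbabilityMeasure m]
    [SMulInvariantMeasure Γ X m] (f : L2Zero m) : koopmanIsometry Γ m 1 f = f := by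
  refine Subtype.ext (Lp.ext ?_)
  filter_upwards [koopmanIsometry_coeFn Γ m 1 f] with x hx
  simpa using hx

theorem koopmanIsometry_mul (m : Measure X) [IsProbabilityMeasure m]
    [SMulInvariantMeasure Γ X m] (a b : Γ) (f : L2Zero m) :
    koopmanIsometry Γ m (a * b) f = koopmanIsometry Γ m a (koopmanIsometry Γ m b f) := by
  refine Subtype.ext (Lp.ext ?_)
  filter_upwards [koopmanIsometry_coeFn Γ m (a * b) f,
    koopmanIsometry_coeFn Γ m a (koopmanIsometry Γ m b f),
    (measurePreserving_smul a⁻¹ m).quasiMeasurePreserving.ae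
      (koopmanIsometry_coeFn Γ m b f)] with x h1 h2 h3
  rw [h1, h2, h3, mul_inv_rev, mul_smul]

/-- The Koopman representation `π₀(γ) f (x) = f(γ⁻¹ x)` of a discrete group `Γ` on `L²₀(X, m)`,
for an action preserving the probability measure `m`. -/
def koopmanRep [TopologicalSpace Γ] [DiscreteTopology Γ] (m : Measure X)
    [IsProbabilityMeasure m] [SMulInvariantMeasure Γ X m] : UnitaryRep Γ (L2Zero m) where
  toHom :=
    { toFun := fun γ =>
        { toLinearEquiv := LinearEquiv.ofLinearMap (koopmanIsometry Γ m γ).toLinearMap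
            (koopmanIsometry Γ m γ⁻¹).toLinearMap
            (LinearMap.ext fun f => by
              change koopmanIsometry Γ m γ (koopmanIsometry Γ m γ⁻¹ f) = f
              rw [← koopmanIsometry_mul, mul_inv_cancel, koopmanIsometry_one])
            (LinearMap.ext fun f => by
              change koopmanIsometry Γ m γ⁻¹ (koopmanIsometry Γ m γ f) = f
              rw [← koopmanIsometry_mul, inv_mul_cancel, koopmanIsometry_one])
          norm_map' := (koopmanIsometry Γ m γ).norm_map }
      map_one' := LinearIsometryEquiv.ext (koopmanIsometry_one Γ m)
      map_mul' := fun a b => LinearIsometryEquiv.ext (koopmanIsometry_mul Γ m a b) }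
  continuous_apply _ := continuous_of_discreteTopology

end Koopman

/-! ### Compact groups and solenoids -/

/-- The covering dimension of `X` is at most `n`: every finite open cover has an open refinement
such that each point lies in at most `n + 1` of its members. -/
def CoveringDimLE (X : Type u) [TopologicalSpace X] (n : ℕ) : Prop :=
  ∀ (k : ℕ) (U : Fin k → Set X), (∀ i, IsOpen (U i)) → (⋃ i, U i) = Set.univ →
    ∃ V : Fin k → Set X, (∀ i, IsOpen (V i)) ∧ (∀ i, V i ⊆ U i) ∧ (⋃ i, V i) = Set.univ ∧
      ∀ x, {i | x ∈ V i}.ncard ≤ n + 1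

/-- `X` has finite covering dimension. -/
def FiniteDimensionalSpace (X : Type u) [TopologicalSpace X] : Prop :=
  ∃ n, CoveringDimLE X n

/-- A solenoid: a compact (Hausdorff) connected abelian group of finite dimension. -/
class IsSolenoid (K : Type u) [CommGroup K] [TopologicalSpace K] : Prop
    extends IsTopologicalGroup K, CompactSpace K, T2Space K, ConnectedSpace K where
  finite_dim : FiniteDimensionalSpace K

section Haar

variable (K : Type v) [CommGroup K] [TopologicalSpace K] [IsTopologicalGroup K] [CompactSpace K]
  [MeasurableSpace K] [BorelSpace K]

/-- The normalized Haar measure of a compact group. -/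
def haarProb : Measure K := Measure.haarMeasure (⊤ : PositiveCompacts K)

instance haarProb.instIsHaarMeasure : (haarProb K).IsHaarMeasure :=
  Measure.isHaarMeasure_haarMeasure _

instance haarProb.instRegular : (haarProb K).Regular :=
  Measure.regular_haarMeasure

instance haarProb.instIsProbabilityMeasure : IsProbabilityMeasure (haarProb K) :=
  ⟨by simpa [haarProb] using Measure.haarMeasure_self (K₀ := (⊤ : PositiveCompacts K))⟩

/-- Continuous automorphisms preserve the normalized Haar measure. -/
instance haarProb.instSMulInvariantMeasure (Γ : Type u) [Group Γ] [MulDistribMulAction Γ K]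
    [ContinuousConstSMul Γ K] : SMulInvariantMeasure Γ K (haarProb K) := by
  refine ⟨fun γ s hs => ?_⟩
  let e : K ≃ₜ* K :=
    { MulDistribMulAction.toMulEquiv K γ with
      continuous_toFun := continuous_const_smul γ
      continuous_invFun := continuous_const_smul γ⁻¹ }
  have he : ⇑e = (γ • ·) := rfl
  have hm : Measurable e := e.continuous_toFun.measurable
  have : IsProbabilityMeasure ((haarProb K).map e) :=
    Measure.isProbabilityMeasure_map hm.aemeasurable
  have : ((haarProb K).map e).IsHaarMeasure := ContinuousMulEquiv.isHaarMeasure_map _ e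
  have : ((haarProb K).map e).Regular := Measure.Regular.map e.toHomeomorph
  have h : (haarProb K).map e = haarProb K := Measure.isHaarMeasure_eq_of_isProbabilityMeasure _ _
  rw [← he, ← Measure.map_apply hm hs, h]

end Haar

end

/-! The argument is by contradiction. Since `π₀(μ)` is a contraction, spectral radius at least one
puts some `c` of modulus one in its spectrum. Such a `c` is a limit of resolvent points, hence an
approximate eigenvalue: there are unit vectors `v n` with `π₀(μ) (v n) - c • v n → 0`. A unit ball
in a Hilbert space is uniformly convex, so an average of unit vectors close to a unit vector forces
`π₀(γ) (v n) - c • v n → 0` at every atom `γ` (`measureReal_singleton_mul_norm_sub_sq_le`).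

The phase `c` is removed by passing to `v n ⊗ conj (v n)`, where it meets its conjugate. The
elements of `Γ` asymptotically fixing these tensors form a subgroup containing the support of `μ`,
which is all of `Γ` because `μ` is adapted.

On the completed tensor square, let `Γ` act diagonally and `K` by translations on the first factor
only; this is a representation of the semidirect product. Strong relative property (T) yields a
nonzero `K`-invariant vector. Its slices in the first factor are translation-invariant functions of
mean zero, hence vanish (`eq_zero_of_forall_koopmanHom_eq`), so the vector vanishes too
(`false_of_almostInvariant_tensor`). -/

open Filter Topology
open scoped TensorProduct

noncomputable section

/-! ### Approximate eigenvectors of contractions -/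

/-- A contraction of spectral radius at least one has a unimodular approximate eigenvalue. -/
theorem ContinuousLinearMap.exists_approx_eigenvector_of_one_le_spectralRadius
    {H : Type v} [NormedAddCommGroup H] [InnerProductSpace ℂ H] [CompleteSpace H]
    (T : H →L[ℂ] H) (hT : ‖T‖ ≤ 1) (h : 1 ≤ spectralRadius ℂ T) :
    ∃ c : ℂ, ‖c‖ = 1 ∧ ∀ ε : ℝ, 0 < ε → ∃ v : H, ‖v‖ = 1 ∧ ‖T v - c • v‖ < ε := by
  have hH : Nontrivial H := by
    by_contra hH
    have : Subsingleton H := not_nontrivial_iff_subsingleton.1 hH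
    have : Subsingleton (H →L[ℂ] H) := ⟨fun a b => ContinuousLinearMap.ext fun x =>
      Subsingleton.elim _ _⟩
    rw [spectrum.SpectralRadius.of_subsingleton] at h
    simp at h
  obtain ⟨c, hc, hcr⟩ := spectrum.exists_nnnorm_eq_spectralRadius T
  have hc1 : ‖c‖ = 1 := by
    refine le_antisymm ((spectrum.norm_le_norm_of_mem hc).trans hT) ?_
    rw [← hcr] at h
    exact_mod_cast h
  refine ⟨c, hc1, fun ε hε => ?_⟩
  by_contra! hbd
  have hbd' (v : H) : ε * ‖v‖ ≤ ‖T v - c • v‖ := by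
    rcases eq_or_ne v 0 with rfl | hv
    · simp
    have hv' : ‖v‖ ≠ 0 := norm_ne_zero_iff.2 hv
    have h1 := hbd ((‖v‖⁻¹ : ℂ) • v) (by simp [norm_smul, hv'])
    rw [map_smul, smul_comm c, ← smul_sub, norm_smul] at h1
    have h2 : ‖(‖v‖⁻¹ : ℂ)‖ = ‖v‖⁻¹ := by simp
    rw [h2, inv_mul_eq_div, le_div_iff₀ (by positivity)] at h1
    exact h1
  -- `z` lies outside the closed unit disc, at distance `ε / 3` from `c`. The lower bound `ε` for `T
  -- - c` leaves `2 * ε / 3` for `T - z`, which exceeds that distance; a Neumann perturbation then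
  -- makes `c - T` invertible.
  set z : ℂ := (1 + ε / 3 : ℝ) * c with hz
  have hzn : ‖z‖ = 1 + ε / 3 := by
    rw [hz, norm_mul, hc1, mul_one, Complex.norm_real, Real.norm_of_nonneg (by positivity)]
  have hzr : z ∈ resolventSet ℂ T :=
    spectrum.mem_resolventSet_of_norm_lt (by rw [hzn]; linarith)
  obtain ⟨U, hU⟩ := spectrum.mem_resolventSet_iff.1 hzr
  have hzc : ‖c - z‖ = ε / 3 := by
    have : c - z = -((ε / 3 : ℝ) : ℂ) * c := by rw [hz]; push_cast; ring
    rw [this, norm_mul, hc1, mul_one, norm_neg, Complex.norm_real,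
      Real.norm_of_nonneg (by positivity)]
  have hinv : ‖((U⁻¹ : (H →L[ℂ] H)ˣ) : H →L[ℂ] H)‖ ≤ (2 * ε / 3)⁻¹ := by
    refine ContinuousLinearMap.opNorm_le_bound _ (by positivity) fun w => ?_
    set v := ((U⁻¹ : (H →L[ℂ] H)ˣ) : H →L[ℂ] H) w
    have hw : w = z • v - T v := by
      have : ((U : H →L[ℂ] H) * ((U⁻¹ : (H →L[ℂ] H)ˣ) : H →L[ℂ] H)) w = w := by
        rw [Units.mul_inv]; rfl
      rw [mul_apply_eq_comp, hU] at this
      simpa [Algebra.algebraMap_eq_smul_one] using this.symm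
    have h3 : ‖T v - c • v‖ ≤ ‖w‖ + ε / 3 * ‖v‖ := by
      have : T v - c • v = -w - (c - z) • v := by rw [hw, sub_smul]; abel
      rw [this, ← hzc, ← norm_smul, ← norm_neg w]
      exact norm_sub_le _ _
    rw [inv_mul_eq_div, le_div_iff₀ (by positivity)]
    linarith [hbd' v]
  have hUpos : 0 < ‖((U⁻¹ : (H →L[ℂ] H)ˣ) : H →L[ℂ] H)‖ := Units.norm_pos _
  have hlt : ‖algebraMap ℂ (H →L[ℂ] H) (c - z)‖ <
      ‖((U⁻¹ : (H →L[ℂ] H)ˣ) : H →L[ℂ] H)‖⁻¹ := by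
    rw [norm_algebraMap', hzc]
    calc ε / 3 < 2 * ε / 3 := by linarith
      _ ≤ _ := by rw [← inv_inv (2 * ε / 3)]; exact inv_anti₀ hUpos hinv
  refine hc (spectrum.mem_resolventSet_iff.2 ?_)
  have := (U.add _ hlt).isUnit
  rw [Units.val_add, hU] at this
  convert this using 1
  rw [map_sub]; abel

/-! ### Almost eigenvectors of averages -/

namespace UnitaryRep

variable {G : Type u} [Group G] [TopologicalSpace G] [IsTopologicalGroup G] [MeasurableSpace G]
  [BorelSpace G] {E : Type v} [NormedAddCommGroup E] [InnerProductSpace ℂ E] [CompleteSpace E]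

theorem average_apply (π : UnitaryRep G E) (μ : Measure G) [IsProbabilityMeasure μ] [μ.Regular]
    (v : E) : π.average μ v = ∫ g, π.toHom g v ∂μ := rfl

theorem norm_average_le_one (π : UnitaryRep G E) (μ : Measure G) [IsProbabilityMeasure μ]
    [μ.Regular] : ‖π.average μ‖ ≤ 1 :=
  LinearMap.mkContinuous_norm_le _ zero_le_one _

/-- Unit vectors almost fixed by the average up to a unimodular scalar are almost fixed, up to
the same scalar, by every atom. -/
theorem measureReal_singleton_mul_norm_sub_sq_le [T1Space G] (π : UnitaryRep G E) (μ : Measure G)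
    [IsProbabilityMeasure μ] [μ.Regular] {c : ℂ} (hc : ‖c‖ = 1) {v : E} (hv : ‖v‖ = 1) (g : G) :
    μ.real {g} * ‖π.toHom g v - c • v‖ ^ 2 ≤ 2 * ‖π.average μ v - c • v‖ := by
  have hcv : ‖c • v‖ = 1 := by rw [norm_smul, hc, hv, one_mul]
  have hsq (h : G) : ‖π.toHom h v - c • v‖ ^ 2 =
      2 - 2 * RCLike.re (inner ℂ (c • v) (π.toHom h v)) := by
    rw [@norm_sub_sq ℂ, (π.toHom h).norm_map, hv, hcv, inner_re_symm]; ring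
  have hint : Integrable (fun h => RCLike.re (inner ℂ (c • v) (π.toHom h v))) μ :=
    ((π.integrable_apply μ v).const_inner (c • v)).re
  have hint2 : Integrable (fun h => ‖π.toHom h v - c • v‖ ^ 2) μ := by
    simp_rw [hsq]
    exact (integrable_const _).sub (hint.const_mul 2)
  -- The atom contributes at most the whole mean square deviation, which is linear in the average
  -- because all vectors involved have norm one.
  calc μ.real {g} * ‖π.toHom g v - c • v‖ ^ 2
      = ∫ h in {g}, ‖π.toHom h v - c • v‖ ^ 2 ∂μ := by
        rw [integral_singleton, smul_eq_mul]
    _ ≤ ∫ h, ‖π.toHom h v - c • v‖ ^ 2 ∂μ :=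
        setIntegral_le_integral hint2 (.of_forall fun h => by positivity)
    _ = 2 - 2 * RCLike.re (inner ℂ (c • v) (π.average μ v)) := by
        simp_rw [hsq]
        rw [integral_sub (integrable_const _) (hint.const_mul 2), integral_const_mul,
          integral_re ((π.integrable_apply μ v).const_inner (c • v)),
          integral_inner (π.integrable_apply μ v), average_apply, integral_const, probReal_univ,
          one_smul]
    _ = -2 * RCLike.re (inner ℂ (c • v) (π.average μ v - c • v)) := by
        rw [inner_sub_right, map_sub, inner_self_eq_norm_sq, hcv]; ring
    _ ≤ 2 * ‖π.average μ v - c • v‖ := by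
        have h1 := (RCLike.abs_re_le_norm _).trans
          (norm_inner_le_norm (𝕜 := ℂ) (c • v) (π.average μ v - c • v))
        rw [hcv, one_mul] at h1
        linarith [(abs_le.1 h1).1]

end UnitaryRep

/-! ### Extending isometries to completions, tensor products -/

section Extension

variable {E : Type v} [NormedAddCommGroup E] [InnerProductSpace ℂ E]

/-- Every inner product space embeds densely in a Hilbert space of any larger universe. -/
theorem exists_linearIsometry_denseRange (E : Type v) [NormedAddCommGroup E]
    [InnerProductSpace ℂ E] :
    ∃ (F : Type (max u v)) (_ : NormedAddCommGroup F) (_ : InnerProductSpace ℂ F)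
      (_ : CompleteSpace F) (e : E →ₗᵢ[ℂ] F), DenseRange e := by
  let C := UniformSpace.Completion E
  -- A one-point `ℓ²` sum serves only to raise the universe: `RelativePropertyT` tests Hilbert
  -- spaces in the universe of the group.
  let F := PiLp 2 fun _ : PUnit.{u + 1} => C
  let j : C ≃ₗᵢ[ℂ] F :=
    { toFun := fun x => WithLp.toLp 2 fun _ => x
      invFun := fun y => y PUnit.unit
      map_add' := fun _ _ => rfl
      map_smul' := fun _ _ => rfl
      left_inv := fun _ => rfl
      right_inv := fun _ => rfl
      norm_map' := fun x => by
        change ‖(WithLp.toLp 2 fun _ : PUnit.{u + 1} => x : F)‖ = ‖x‖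
        simp [PiLp.norm_eq_of_L2, Real.sqrt_sq (norm_nonneg x)] }
  refine ⟨F, inferInstance, inferInstance, inferInstance,
    j.toLinearIsometry.comp UniformSpace.Completion.toComplₗᵢ, ?_⟩
  exact j.surjective.denseRange.comp UniformSpace.Completion.denseRange_coe j.continuous

variable {F : Type w} [NormedAddCommGroup F] [InnerProductSpace ℂ F] [CompleteSpace F]

/-- The extension of unitary operators along a dense isometric embedding. -/
def LinearIsometry.extendUnitary (e : E →ₗᵢ[ℂ] F) (he : DenseRange e) :
    (E ≃ₗᵢ[ℂ] E) →* (F ≃ₗᵢ[ℂ] F) where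
  toFun U := U.toLinearEquiv.extendOfIsometry e.toLinearMap e.toLinearMap he he
    fun x => (e.norm_map _).trans ((U.norm_map x).trans (e.norm_map x).symm)
  map_one' := LinearIsometryEquiv.ext fun y => by
    refine congrFun (he.equalizer (LinearIsometryEquiv.continuous _)
      (LinearIsometryEquiv.continuous _) (funext fun x => ?_)) y
    exact LinearEquiv.extendOfIsometry_eq _ _ _ he he _ x
  map_mul' U V := LinearIsometryEquiv.ext fun y => by
    refine congrFun (he.equalizer (LinearIsometryEquiv.continuous _)
      (LinearIsometryEquiv.continuous _) (funext fun x => ?_)) y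
    refine (LinearEquiv.extendOfIsometry_eq _ _ _ he he _ x).trans ?_
    refine .trans ?_ (congrArg _ (LinearEquiv.extendOfIsometry_eq _ _ _ he he _ x)).symm
    exact (LinearEquiv.extendOfIsometry_eq _ _ _ he he _ (V x)).symm

theorem LinearIsometry.extendUnitary_apply (e : E →ₗᵢ[ℂ] F) (he : DenseRange e)
    (U : E ≃ₗᵢ[ℂ] E) (x : E) : e.extendUnitary he U (e x) = e (U x) :=
  LinearEquiv.extendOfIsometry_eq U.toLinearEquiv e.toLinearMap e.toLinearMap he he
    (fun x => (e.norm_map _).trans ((U.norm_map x).trans (e.norm_map x).symm)) x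

/-- Tensor products of unitary operators. -/
def tensorUnitary (E : Type v) [NormedAddCommGroup E] [InnerProductSpace ℂ E]
    (F : Type w) [NormedAddCommGroup F] [InnerProductSpace ℂ F] :
    (E ≃ₗᵢ[ℂ] E) × (F ≃ₗᵢ[ℂ] F) →* (E ⊗[ℂ] F ≃ₗᵢ[ℂ] E ⊗[ℂ] F) where
  toFun U := TensorProduct.congrIsometry U.1 U.2
  map_one' := TensorProduct.congrIsometry_refl_refl
  map_mul' U V := LinearIsometryEquiv.ext fun x => by
    induction x with
    | zero => simp
    | tmul a b => rfl
    | add x y hx hy => rw [map_add, map_add, hx, hy]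

theorem tensorUnitary_tmul {F : Type w} [NormedAddCommGroup F] [InnerProductSpace ℂ F]
    (U : E ≃ₗᵢ[ℂ] E) (V : F ≃ₗᵢ[ℂ] F) (a : E) (b : F) :
    tensorUnitary E F (U, V) (a ⊗ₜ b) = U a ⊗ₜ V b := rfl

end Extension

/-! ### Translations on mean-zero functions -/

section Translation

variable (G : Type u) {X : Type v} [Group G] [MeasurableSpace X] [MulAction G X]
  [MeasurableConstSMul G X]

/-- The homomorphism underlying the Koopman representation, with no topology on the group. -/
def koopmanHom (m : Measure X) [IsProbabilityMeasure m] [SMulInvariantMeasure G X m] :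
    G →* (L2Zero m ≃ₗᵢ[ℂ] L2Zero m) :=
  -- The discrete topology makes the continuity field of `koopmanRep` trivial; only the homomorphism
  -- is kept.
  letI : TopologicalSpace G := ⊥
  haveI : DiscreteTopology G := ⟨rfl⟩
  (koopmanRep G m).toHom

theorem koopmanHom_coeFn (m : Measure X) [IsProbabilityMeasure m] [SMulInvariantMeasure G X m]
    (g : G) (f : L2Zero m) :
    ((koopmanHom G m g f : Lp ℂ 2 m) : X → ℂ) =ᵐ[m] fun x => (f : Lp ℂ 2 m) (g⁻¹ • x) :=
  koopmanIsometry_coeFn G m g f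

/-- Complex conjugation on `L²₀`. -/
def L2Zero.conj {m : Measure X} [IsProbabilityMeasure m] (f : L2Zero m) : L2Zero m :=
  ⟨star (f : Lp ℂ 2 m), by
    rw [mem_L2Zero, integral_congr_ae (Lp.coeFn_star (f : Lp ℂ 2 m))]
    have h := integral_conj (f := ((f : Lp ℂ 2 m) : X → ℂ)) (μ := m)
    rw [mem_L2Zero.1 f.2, map_zero] at h
    exact h⟩

theorem L2Zero.conj_coeFn {m : Measure X} [IsProbabilityMeasure m] (f : L2Zero m) :
    (((L2Zero.conj f) : Lp ℂ 2 m) : X → ℂ) =ᵐ[m] fun x => star ((f : Lp ℂ 2 m) x) :=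
  Lp.coeFn_star (f : Lp ℂ 2 m)

theorem L2Zero.norm_conj {m : Measure X} [IsProbabilityMeasure m] (f : L2Zero m) :
    ‖(L2Zero.conj f)‖ = ‖f‖ := by
  refine le_antisymm (Lp.norm_le_norm_of_ae_le ?_) (Lp.norm_le_norm_of_ae_le ?_) <;>
  · filter_upwards [L2Zero.conj_coeFn f] with x hx
    have h : ‖(L2Zero.conj f : Lp ℂ 2 m) x‖ = ‖(f : Lp ℂ 2 m) x‖ := by rw [hx, norm_star]
    first | exact h.le | exact h.ge

theorem L2Zero.conj_sub {m : Measure X} [IsProbabilityMeasure m] (f g : L2Zero m) :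
    L2Zero.conj (f - g) = (L2Zero.conj f) - (L2Zero.conj g) := by
  refine Subtype.ext (Lp.ext ?_)
  filter_upwards [L2Zero.conj_coeFn (f - g), L2Zero.conj_coeFn f, L2Zero.conj_coeFn g,
    Lp.coeFn_sub (f : Lp ℂ 2 m) (g : Lp ℂ 2 m),
    Lp.coeFn_sub ((L2Zero.conj f) : Lp ℂ 2 m) ((L2Zero.conj g) : Lp ℂ 2 m)] with x h1 h2 h3 h4 h5
  rw [h1]
  refine .trans ?_ h5.symm
  rw [Pi.sub_apply, h2, h3, ← star_sub]
  exact congrArg star h4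

theorem L2Zero.conj_smul {m : Measure X} [IsProbabilityMeasure m] (c : ℂ) (f : L2Zero m) :
    L2Zero.conj (c • f) = star c • (L2Zero.conj f) := by
  refine Subtype.ext (Lp.ext ?_)
  filter_upwards [L2Zero.conj_coeFn (c • f), L2Zero.conj_coeFn f, Lp.coeFn_smul c (f : Lp ℂ 2 m),
    Lp.coeFn_smul (star c) ((L2Zero.conj f) : Lp ℂ 2 m)] with x h1 h2 h3 h4
  rw [h1]
  refine .trans ?_ h4.symm
  rw [Pi.smul_apply, h2, smul_eq_mul, ← star_mul']
  exact congrArg star h3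

/-- Koopman operators are real, so conjugating an almost eigenvector for `c` gives one for `star c`.
-/
theorem koopmanHom_conj (m : Measure X) [IsProbabilityMeasure m] [SMulInvariantMeasure G X m]
    (g : G) (f : L2Zero m) : koopmanHom G m g (L2Zero.conj f) = L2Zero.conj (koopmanHom G m g f) := by
  refine Subtype.ext (Lp.ext ?_)
  filter_upwards [koopmanHom_coeFn G m g (L2Zero.conj f), L2Zero.conj_coeFn (koopmanHom G m g f),
    koopmanHom_coeFn G m g f,
    (measurePreserving_smul g⁻¹ m).quasiMeasurePreserving.ae (L2Zero.conj_coeFn f)] with x h1 h2 h3 h4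
  rw [h1, h2, h3, h4]

end Translation

section CompactGroup

variable {K : Type v} [CommGroup K] [TopologicalSpace K] [IsTopologicalGroup K] [CompactSpace K]
  [MeasurableSpace K] [BorelSpace K]

/-- Continuity for the compact topology of `K`, which the construction of `koopmanHom` ignores. -/
theorem continuous_koopmanHom_apply [T2Space K] (f : L2Zero (haarProb K)) :
    Continuous fun x : K => koopmanHom K (haarProb K) x f := by
  refine Continuous.subtype_mk (Continuous.compMeasurePreservingLp (f := fun _ : K => f.1)
    (g := fun x : K => (⟨fun y => x⁻¹ • y, by fun_prop⟩ : C(K, K))) continuous_const ?_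
    (fun x => measurePreserving_smul x⁻¹ (haarProb K)) (by norm_num)) _
  exact ContinuousMap.continuous_of_continuous_uncurry _ (by dsimp; fun_prop)

/-- Translation-invariant mean-zero functions on a compact group vanish. -/
theorem eq_zero_of_forall_koopmanHom_eq [T2Space K] (f : L2Zero (haarProb K))
    (hf : ∀ x : K, koopmanHom K (haarProb K) x f = f) : f = 0 := by
  set m := haarProb K
  -- By invariance `f` pairs equally with all translates of `φ`, hence with their Haar average. That
  -- average is a constant function, and `f` has mean zero.
  have key (φ : C(K, ℂ)) : inner ℂ (f : Lp ℂ 2 m) (ContinuousMap.toLp 2 m ℂ φ) = 0 := by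
    let τ : K → C(K, ℂ) := fun x => φ.comp ⟨fun y => x * y, by fun_prop⟩
    have hτ : Continuous τ :=
      ContinuousMap.continuous_of_continuous_uncurry _ (by dsimp [τ]; fun_prop)
    have hτi : Integrable τ m := by
      obtain ⟨C, hC⟩ := isCompact_univ.exists_bound_of_continuousOn hτ.continuousOn
      exact .of_bound (aestronglyMeasurable_of_continuous_of_regular m hτ) C
        (.of_forall fun x => hC x trivial)
    let Λ : C(K, ℂ) →L[ℂ] ℂ := (innerSL ℂ (f : Lp ℂ 2 m)).comp (ContinuousMap.toLp 2 m ℂ)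
    have hΛ (x : K) : Λ (τ x) = Λ φ := by
      have h1 : Lp.compMeasurePreserving (x • ·) (measurePreserving_smul x m)
          (ContinuousMap.toLp 2 m ℂ φ) = ContinuousMap.toLp 2 m ℂ (τ x) := by
        refine Lp.ext ?_
        filter_upwards [Lp.coeFn_compMeasurePreserving (ContinuousMap.toLp 2 m ℂ φ)
          (measurePreserving_smul x m), ContinuousMap.coeFn_toLp (𝕜 := ℂ) (p := 2) m (τ x),
          (measurePreserving_smul x m).quasiMeasurePreserving.ae
            (ContinuousMap.coeFn_toLp (𝕜 := ℂ) (p := 2) m φ)] with y h1 h2 h3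
        rw [h1, h2, Function.comp_apply, h3]
        rfl
      have h2 : Lp.compMeasurePreserving (x • ·) (measurePreserving_smul x m) (f : Lp ℂ 2 m)
          = f := by
        have h := congrArg Subtype.val (hf x⁻¹)
        refine .trans (Lp.ext ?_) h
        filter_upwards [Lp.coeFn_compMeasurePreserving (f : Lp ℂ 2 m)
          (measurePreserving_smul x m), koopmanHom_coeFn K m x⁻¹ f] with y h1 h2
        rw [h1, h2, inv_inv, Function.comp_apply]
      change inner ℂ (f : Lp ℂ 2 m) (ContinuousMap.toLp 2 m ℂ (τ x)) = _
      rw [← h1]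
      conv_lhs => rw [← h2]
      exact (Lp.compMeasurePreservingₗᵢ ℂ (x • ·) (measurePreserving_smul x m)).inner_map_map
        (f : Lp ℂ 2 m) (ContinuousMap.toLp 2 m ℂ φ)
    have hJ : ∫ x, τ x ∂m = ContinuousMap.const K (∫ x, φ x ∂m) := by
      ext y
      have h := (ContinuousMap.evalCLM ℂ y).integral_comp_comm hτi
      refine h.symm.trans ?_
      change ∫ x, φ (x * y) ∂m = ∫ x, φ x ∂m
      simp_rw [mul_comm _ y]
      exact integral_mul_left_eq_self (fun x => φ x) y
    have h3 : Λ (∫ x, τ x ∂m) = Λ φ := by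
      rw [← Λ.integral_comp_comm hτi]
      simp [hΛ]
    change Λ φ = 0
    rw [← h3, hJ]
    change inner ℂ (f : Lp ℂ 2 m) (ContinuousMap.toLp 2 m ℂ (ContinuousMap.const K _)) = 0
    rw [L2.inner_def, integral_congr_ae (g := fun x =>
      (∫ x, φ x ∂m) * (starRingEnd ℂ) ((f : Lp ℂ 2 m) x)), integral_const_mul, integral_conj,
      mem_L2Zero.1 f.2, map_zero, mul_zero]
    filter_upwards [ContinuousMap.coeFn_toLp (𝕜 := ℂ) (p := 2) m
      (ContinuousMap.const K (∫ x, φ x ∂m))] with x hx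
    rw [hx, RCLike.inner_apply]
    rfl
  refine Subtype.ext ?_
  refine (ContinuousMap.toLp_denseRange ℂ m ℂ (p := 2) (by norm_num)).eq_zero_of_inner_left
    (𝕜 := ℂ) ?_
  exact key

/-- The translations and the automorphisms of `K` satisfy the semidirect product relation. -/
theorem koopmanHom_smul {Γ : Type u} [Group Γ] [MulDistribMulAction Γ K]
    [ContinuousConstSMul Γ K] (γ : Γ) (x : K) :
    koopmanHom K (haarProb K) (γ • x) =
      koopmanHom Γ (haarProb K) γ * koopmanHom K (haarProb K) x *
        (koopmanHom Γ (haarProb K) γ)⁻¹ := by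
  rw [eq_mul_inv_iff_mul_eq]
  refine LinearIsometryEquiv.ext fun f => Subtype.ext (Lp.ext ?_)
  have q (y : K) := (measurePreserving_smul y⁻¹ (haarProb K)).quasiMeasurePreserving
  have q' := (measurePreserving_smul γ⁻¹ (haarProb K)).quasiMeasurePreserving
  filter_upwards [koopmanHom_coeFn K (haarProb K) (γ • x) (koopmanHom Γ (haarProb K) γ f),
    (q (γ • x)).ae (koopmanHom_coeFn Γ (haarProb K) γ f),
    koopmanHom_coeFn Γ (haarProb K) γ (koopmanHom K (haarProb K) x f),
    q'.ae (koopmanHom_coeFn K (haarProb K) x f)] with y h1 h2 h3 h4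
  refine h1.trans (h2.trans (.trans ?_ (h3.trans h4).symm))
  congr 1
  simp [smul_mul']

end CompactGroup

/-! ### Relative property (T) and tensor products -/

/-- Strong continuity of a family of unitary operators may be checked on a dense range. -/
theorem continuous_apply_of_denseRange {X ι E : Type*} [NormedAddCommGroup E]
    [InnerProductSpace ℂ E] [TopologicalSpace X]
    (U : X → (E ≃ₗᵢ[ℂ] E)) {e : ι → E} (he : DenseRange e)
    (h : ∀ i, Continuous fun x => U x (e i)) (v : E) : Continuous fun x => U x v := by
  have h2 : Continuous fun p : E × X => U p.2 p.1 := by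
    refine continuous_prod_of_dense_continuous_lipschitzWith (fun p : E × X => U p.2 p.1) 1 he ?_
      fun x => (U x).isometry.lipschitz
    rintro _ ⟨i, rfl⟩
    exact h i
  exact h2.comp (continuous_const.prodMk continuous_id)

/-- Since `Γ` is discrete, the factorization into a `K` part and a `Γ` part reduces continuity to
`K`. -/
theorem continuous_semidirectProduct_apply {Γ : Type u} {K : Type v} {E : Type w} [Group K]
    [TopologicalSpace K] [Group Γ] [TopologicalSpace Γ] [DiscreteTopology Γ]
    [NormedAddCommGroup E] [InnerProductSpace ℂ E] {φ : Γ →* MulAut K}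
    (W : K ⋊[φ] Γ →* (E ≃ₗᵢ[ℂ] E))
    (h : ∀ v, Continuous fun x => W (SemidirectProduct.inl x) v) (v : E) :
    Continuous fun g => W g v := by
  have h2 : Continuous fun p : K × Γ =>
      W (SemidirectProduct.inl p.1) (W (SemidirectProduct.inr p.2) v) :=
    continuous_prod_of_discrete_right.2 fun γ => h (W (SemidirectProduct.inr γ) v)
  refine (h2.comp continuous_induced_dom).congr fun g => ?_
  conv_rhs => rw [← SemidirectProduct.inl_left_mul_inr_right g, map_mul]
  rfl

section Tensor

variable {Γ : Type u} {K : Type v} [CommGroup K] [Group Γ] [MulDistribMulAction Γ K]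
  {H : Type v} [NormedAddCommGroup H] [InnerProductSpace ℂ H]
  {L : Type v} [NormedAddCommGroup L] [InnerProductSpace ℂ L]
  {E : Type w} [NormedAddCommGroup E] [InnerProductSpace ℂ E] [CompleteSpace E]

/-- On a completion of `H ⊗ L`, the group `K` acts through `H` and `Γ` acts diagonally. -/
def tensorSemidirectHom (ρK : K →* (H ≃ₗᵢ[ℂ] H)) (ρ : Γ →* (H ≃ₗᵢ[ℂ] H)) (σ : Γ →* (L ≃ₗᵢ[ℂ] L))
    (hcompat : ∀ γ x, ρK (γ • x) = ρ γ * ρK x * (ρ γ)⁻¹)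
    (e : H ⊗[ℂ] L →ₗᵢ[ℂ] E) (he : DenseRange e) :
    K ⋊[MulDistribMulAction.toMulAut Γ K] Γ →* (E ≃ₗᵢ[ℂ] E) :=
  let Φ := (e.extendUnitary he).comp (tensorUnitary H L)
  SemidirectProduct.lift (Φ.comp (ρK.prod 1)) (Φ.comp (ρ.prod σ)) fun γ => by
    refine MonoidHom.ext fun x => ?_
    change Φ (ρK (γ • x), 1) = Φ (ρ γ, σ γ) * Φ (ρK x, 1) * (Φ (ρ γ, σ γ))⁻¹
    rw [← map_inv, ← map_mul, ← map_mul, hcompat]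
    simp

theorem tensorSemidirectHom_inl (ρK : K →* (H ≃ₗᵢ[ℂ] H)) (ρ : Γ →* (H ≃ₗᵢ[ℂ] H))
    (σ : Γ →* (L ≃ₗᵢ[ℂ] L)) (hcompat : ∀ γ x, ρK (γ • x) = ρ γ * ρK x * (ρ γ)⁻¹)
    (e : H ⊗[ℂ] L →ₗᵢ[ℂ] E) (he : DenseRange e) (x : K) :
    tensorSemidirectHom ρK ρ σ hcompat e he (SemidirectProduct.inl x) =
      e.extendUnitary he (tensorUnitary H L (ρK x, 1)) := by
  unfold tensorSemidirectHom
  simp only [SemidirectProduct.lift_inl]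
  rfl

theorem tensorSemidirectHom_inr (ρK : K →* (H ≃ₗᵢ[ℂ] H)) (ρ : Γ →* (H ≃ₗᵢ[ℂ] H))
    (σ : Γ →* (L ≃ₗᵢ[ℂ] L)) (hcompat : ∀ γ x, ρK (γ • x) = ρ γ * ρK x * (ρ γ)⁻¹)
    (e : H ⊗[ℂ] L →ₗᵢ[ℂ] E) (he : DenseRange e) (γ : Γ) :
    tensorSemidirectHom ρK ρ σ hcompat e he (SemidirectProduct.inr γ) =
      e.extendUnitary he (tensorUnitary H L (ρ γ, σ γ)) := by
  unfold tensorSemidirectHom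
  simp only [SemidirectProduct.lift_inr]
  rfl

variable [TopologicalSpace K]

theorem continuous_extendUnitary_tensorUnitary_apply (ρK : K →* (H ≃ₗᵢ[ℂ] H))
    (hcont : ∀ f, Continuous fun x => ρK x f) (e : H ⊗[ℂ] L →ₗᵢ[ℂ] E) (he : DenseRange e)
    (v : E) : Continuous fun x => e.extendUnitary he (tensorUnitary H L (ρK x, 1)) v := by
  have h (t : H ⊗[ℂ] L) : Continuous fun x => tensorUnitary H L (ρK x, 1) t := by
    induction t with
    | zero => simpa using continuous_const
    | tmul a b =>
      exact TensorProduct.continuous_tmul.comp ((hcont a).prodMk continuous_const)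
    | add s t hs ht =>
      simp only [map_add]
      exact hs.add ht
  refine continuous_apply_of_denseRange (fun x => e.extendUnitary he (tensorUnitary H L (ρK x, 1)))
    he (fun t => ?_) v
  simp only [LinearIsometry.extendUnitary_apply]
  exact e.continuous.comp (h t)

/-- If `Γ` is discrete, `(Γ, K)` has strong relative property (T) and `K` has no invariant vectors
in `H`, then no tensor product of `H` with a representation of `Γ` has almost invariant vectors. -/
theorem StrongRelativePropertyT.false_of_almostInvariant_tensor
    [TopologicalSpace Γ] [DiscreteTopology Γ] [CompleteSpace H]
    (hT : StrongRelativePropertyT Γ K)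
    (ρK : K →* (H ≃ₗᵢ[ℂ] H)) (ρ : Γ →* (H ≃ₗᵢ[ℂ] H)) (σ : Γ →* (L ≃ₗᵢ[ℂ] L))
    (hcompat : ∀ γ x, ρK (γ • x) = ρ γ * ρK x * (ρ γ)⁻¹)
    (hcont : ∀ f, Continuous fun x => ρK x f)
    (hinv : ∀ f, (∀ x, ρK x f = f) → f = 0)
    (t : ℕ → H ⊗[ℂ] L) (ht : ∀ n, ‖t n‖ = 1)
    (hlim : ∀ γ, Tendsto (fun n => ‖tensorUnitary H L (ρ γ, σ γ) (t n) - t n‖) atTop (𝓝 0)) :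
    False := by
  obtain ⟨E, _, _, _, e, he⟩ := exists_linearIsometry_denseRange.{u, v} (H ⊗[ℂ] L)
  let W := tensorSemidirectHom ρK ρ σ hcompat e he
  have hWK (x : K) : W (SemidirectProduct.inl x) = _ :=
    tensorSemidirectHom_inl ρK ρ σ hcompat e he x
  have hWΓ (γ : Γ) : W (SemidirectProduct.inr γ) = _ :=
    tensorSemidirectHom_inr ρK ρ σ hcompat e he γ
  let π : UnitaryRep (K ⋊[MulDistribMulAction.toMulAut Γ K] Γ) E :=
    { toHom := W
      continuous_apply := continuous_semidirectProduct_apply W fun v => by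
        simp only [hWK]
        exact continuous_extendUnitary_tensorUnitary_apply ρK hcont e he v }
  obtain ⟨v, hv0, hv⟩ := hT E π <| by
    intro Q hQ ε hε
    let r : (SemidirectProduct.inr : Γ →* K ⋊[MulDistribMulAction.toMulAut Γ K] Γ).range → Γ :=
      fun g => g.1.right
    have hright : Continuous fun g : K ⋊[MulDistribMulAction.toMulAut Γ K] Γ => g.right :=
      continuous_snd.comp (f := fun g : K ⋊[MulDistribMulAction.toMulAut Γ K] Γ =>
        (g.left, g.right)) continuous_induced_dom
    have hr : Continuous r := hright.comp continuous_subtype_val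
    -- Compact sets meet only finitely many elements of the discrete group, so pointwise convergence
    -- is uniform on them.
    have hfin : (r '' Q).Finite := (hQ.image hr).finite_of_discrete
    have hev := (hfin.eventually_all (l := atTop)
      (p := fun γ n => ‖tensorUnitary H L (ρ γ, σ γ) (t n) - t n‖ < ε)).2
      fun γ _ => (hlim γ).eventually_lt_const hε
    obtain ⟨n, hn⟩ := hev.exists
    have hnorm : ‖e (t n)‖ = 1 := (e.norm_map _).trans (ht n)
    refine ⟨e (t n), fun h0 => by simp [h0] at hnorm, ?_⟩
    rintro ⟨_, γ, rfl⟩ hg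
    have h := hn γ ⟨_, hg, rfl⟩
    change ‖W (SemidirectProduct.inr γ) (e (t n)) - e (t n)‖ < _
    rwa [hWΓ, LinearIsometry.extendUnitary_apply, ← map_sub, e.norm_map, hnorm, mul_one]
  refine hv0 (he.eq_zero_of_inner_left (𝕜 := ℂ) (x := v) ?_)
  intro s
  induction s with
  | zero => simp
  | add a b ha hb => rw [map_add, inner_add_right, ha, hb, add_zero]
  | tmul a b =>
    -- The Riesz vector `f` of this functional is the slice of `v` along `b`. As `K` acts trivially
    -- on `L`, invariance of `v` passes to `f`.
    let Λ : H →L[ℂ] ℂ := ((innerSL ℂ v).comp e.toContinuousLinearMap).comp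
      ((TensorProduct.mkL ℂ H L).flip b)
    let f := (InnerProductSpace.toDual ℂ H).symm Λ
    have hf (a : H) : inner ℂ f a = inner ℂ v (e (a ⊗ₜ b)) :=
      InnerProductSpace.toDual_symm_apply
    have hf0 : f = 0 := hinv f fun x => ext_inner_right ℂ fun a => by
      have h1 := (ρK x).inner_map_map f ((ρK x)⁻¹ a)
      have h2 : ρK x ((ρK x)⁻¹ a) = a := (ρK x).apply_symm_apply a
      rw [h2] at h1
      rw [h1, hf, hf]
      have h3 := hv (SemidirectProduct.inl x) ⟨x, rfl⟩
      have h4 := (W (SemidirectProduct.inl x)).inner_map_map v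
        (e (((ρK x)⁻¹ a) ⊗ₜ b))
      rw [h3, hWK, LinearIsometry.extendUnitary_apply, tensorUnitary_tmul, h2] at h4
      exact h4.symm
    rw [← hf, hf0, inner_zero_left]

end Tensor

/-- In the tensor square, scalars of modulus one cancel. -/
theorem norm_tmul_sub_tmul_le {H L : Type*} [NormedAddCommGroup H] [InnerProductSpace ℂ H]
    [NormedAddCommGroup L] [InnerProductSpace ℂ L] {c : ℂ} (hc : ‖c‖ = 1) (a a' : H) (b b' : L) :
    ‖a' ⊗ₜ[ℂ] b' - a ⊗ₜ[ℂ] b‖ ≤ ‖a' - c • a‖ * ‖b'‖ + ‖a‖ * ‖b' - star c • b‖ := by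
  have hcc : c * star c = 1 := by
    have := RCLike.mul_conj c
    rw [hc] at this
    simpa using this
  have h : a' ⊗ₜ[ℂ] b' - a ⊗ₜ[ℂ] b =
      (a' - c • a) ⊗ₜ[ℂ] b' + (c • a) ⊗ₜ[ℂ] (b' - star c • b) := by
    rw [TensorProduct.sub_tmul, TensorProduct.tmul_sub, TensorProduct.smul_tmul_smul, hcc,
      one_smul]
    abel
  rw [h]
  refine (norm_add_le _ _).trans_eq ?_
  rw [TensorProduct.norm_tmul, TensorProduct.norm_tmul, norm_smul, hc, one_mul]

/-- The elements of a group that asymptotically fix a given sequence of vectors. -/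
def almostInvariantSubgroup {Γ : Type u} [Group Γ] {E : Type v} [NormedAddCommGroup E]
    [InnerProductSpace ℂ E] (V : Γ →* (E ≃ₗᵢ[ℂ] E)) (t : ℕ → E) : Subgroup Γ where
  carrier := {γ | Tendsto (fun n => ‖V γ (t n) - t n‖) atTop (𝓝 0)}
  one_mem' := by simp
  mul_mem' {a b} ha hb := by
    have hlim := Tendsto.add hb ha
    rw [add_zero] at hlim
    refine squeeze_zero (fun _ => norm_nonneg _) (fun n => ?_) hlim
    have h : V (a * b) (t n) - t n = V a (V b (t n) - t n) + (V a (t n) - t n) := by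
      rw [map_mul, map_sub, LinearIsometryEquiv.coe_mul, Function.comp_apply]; abel
    rw [h]
    exact (norm_add_le _ _).trans_eq (by rw [(V a).norm_map])
  inv_mem' {a} ha := by
    refine Tendsto.congr (fun n => ?_) ha
    have h : V a (V a⁻¹ (t n)) = t n := by
      rw [map_inv]; exact (V a).apply_symm_apply (t n)
    rw [← (V a).norm_map (V a⁻¹ (t n) - t n), map_sub, h, norm_sub_rev]

end

/-! ### The spectral gap -/

theorem mainTheorem12 {Γ : Type u} {K : Type v}
    [CommGroup K] [TopologicalSpace K] [IsSolenoid K] [MeasurableSpace K] [BorelSpace K]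
    [Group Γ] [TopologicalSpace Γ] [DiscreteTopology Γ] [MeasurableSpace Γ] [BorelSpace Γ]
    [MulDistribMulAction Γ K] [ContinuousConstSMul Γ K]
    (hT : StrongRelativePropertyT Γ K)
    (μ : Measure Γ) [IsProbabilityMeasure μ] [μ.Regular] (hμ : IsAdapted μ) :
    spectralRadius ℂ ((koopmanRep Γ (haarProb K)).average μ) < 1 := by
  by_contra! hspr
  set m := haarProb K
  set T := (koopmanRep Γ m).average μ
  obtain ⟨c, hc, happ⟩ := T.exists_approx_eigenvector_of_one_le_spectralRadius
    ((koopmanRep Γ m).norm_average_le_one μ) hspr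
  choose v hv1 hv using fun n : ℕ => happ (1 / (n + 1)) (by positivity)
  have hTv : Tendsto (fun n => ‖T (v n) - c • v n‖) atTop (𝓝 0) :=
    squeeze_zero (fun _ => norm_nonneg _) (fun n => (hv n).le)
      tendsto_one_div_add_atTop_nhds_zero_nat
  let ρ : Γ →* (L2Zero m ≃ₗᵢ[ℂ] L2Zero m) := koopmanHom Γ m
  have hatom (γ : Γ) (hγ : γ ∈ μ.support) :
      Tendsto (fun n => ‖ρ γ (v n) - c • v n‖) atTop (𝓝 0) := by
    -- In a discrete group singletons are open, so points of the support are atoms.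
    have hpos : 0 < μ.real {γ} := by
      have := (Measure.mem_support_iff_forall γ).1 hγ {γ} (by simp)
      exact ENNReal.toReal_pos this.ne' (measure_ne_top μ _)
    have hsq : Tendsto (fun n => ‖ρ γ (v n) - c • v n‖ ^ 2) atTop (𝓝 0) := by
      refine squeeze_zero (g := fun n => (μ.real {γ})⁻¹ * (2 * ‖T (v n) - c • v n‖))
        (fun _ => by positivity) (fun n => ?_) (by simpa using (hTv.const_mul 2).const_mul _)
      rw [← mul_le_mul_iff_right₀ hpos, mul_inv_cancel_left₀ hpos.ne']
      exact (koopmanRep Γ m).measureReal_singleton_mul_norm_sub_sq_le μ hc (hv1 n) γ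
    simpa [Real.sqrt_sq] using hsq.sqrt
  let t : ℕ → L2Zero m ⊗[ℂ] L2Zero m := fun n => v n ⊗ₜ L2Zero.conj (v n)
  let V : Γ →* (L2Zero m ⊗[ℂ] L2Zero m ≃ₗᵢ[ℂ] L2Zero m ⊗[ℂ] L2Zero m) :=
    (tensorUnitary _ _).comp (ρ.prod ρ)
  let S : Subgroup Γ := almostInvariantSubgroup V t
  have hS : S = ⊤ := hμ S (isClosed_discrete _) fun γ hγ => by
    -- Both tensor factors contribute the same error, since conjugation is isometric and commutes
    -- with `ρ γ`.
    have hlim := (hatom γ hγ).add (hatom γ hγ)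
    rw [add_zero] at hlim
    refine squeeze_zero (fun _ => norm_nonneg _) (fun n => ?_) hlim
    refine (norm_tmul_sub_tmul_le hc (v n) (ρ γ (v n)) (L2Zero.conj (v n))
      (ρ γ (L2Zero.conj (v n)))).trans_eq ?_
    rw [koopmanHom_conj, ← L2Zero.conj_smul, ← L2Zero.conj_sub, L2Zero.norm_conj,
      L2Zero.norm_conj, LinearIsometryEquiv.norm_map, hv1, one_mul, mul_one]
  refine hT.false_of_almostInvariant_tensor (koopmanHom K m) ρ ρ koopmanHom_smul
    continuous_koopmanHom_apply eq_zero_of_forall_koopmanHom_eq t (fun n => ?_) fun γ => ?_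
  · rw [TensorProduct.norm_tmul, L2Zero.norm_conj, hv1, one_mul]
  · exact (hS ▸ Subgroup.mem_top γ : γ ∈ S)
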